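/- Let a (real, non-degenerate) conic in $\mathbb C$ be given by \[ C:\ c(z)=\overline a z^2+p z\overline z+a\overline z^2+\overline b z+b\overline z+q=0\qquad(a,b\in\mathbb C,\ p,q\in\mathbb R), \] where non-degenerate means that $C$ is an ellipse (possibly a circle), a hyperbola or a parabola; equivalently, $C\ne\emptyset$ and the symmetric matrix of $c$ as a quadratic form in $(z,\overline z,1)$ is invertible. Put $F_4(z)=W_6z^6+W_5z^5+W_4z^4+W_3z^3+W_2z^2+W_1z+W_0$, where \begin{align*} W_6&=4\overline{a}(\overline{b}bp-\overline{b}^2a -\overline{a}b^2)(p^2-4\overline{a}a),\\ W_5&= -2\Big[ bp^5-\overline{b}(a+\overline{a})p^4-b(4\overline{a}q+8\overline{a}a +\overline{b}^2)p^3 +\overline{b}\big( 8\overline{a}aq+8\overline{a}a^2 +(8\overline{a}^2+\overline{b}^2)a \\ & -3\overline{a}b^2\big)p^2 +4\overline{a}b(4\overline{a}aq+4\overline{a}a^2+4\overline{b}^2a +\overline{a}b^2)p-4a\overline{a}\overline{b} \big( 8\overline{a}aq +4\overline{a}a^2\\ & +(4\overline{a}^2+3\overline{b}^2)a+3\overline{a}b^2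 \big)\Big],\\ W_4&=-\Big[p^6-\big( (4a+4\overline{a})q+a^2+10\overline{a}a-9b^2+\overline{a}^2 +\overline{b}^2\big)p^4-2b\overline{b}(2q+11a+\overline{a})p^3 \\ & +\Big(16\overline{a}aq^2+4\big( 8\overline{a}a^2+(8\overline{a}^2+2\overline{b}^2)a -5\overline{a}b^2\big)q +8\overline{a}a^3+(32\overline{a}^2+14\overline{b}^2)a^2 \\ & +(-42\overline{a}b^2+8\overline{a}^3+18\overline{b}^2\overline{a})a +(-6\overline{a}^2-5\overline{b}^2)b^2\Big)p^2 +2b\overline{b}\big( 48\overline{a}aq+44\overline{a}a^2 \\ & +(4\overline{a}^2+7\overline{b}^2)a +\overline{a}b^2\big)p -64\overline{a}^2a^2q^2-16a^2\overline{a}(4\overline{a}a+4\overline{a}^2 +7\overline{b}^2)q -16\overline{a}^2a^4-(32\overline{a}^3 \\ & +56\overline{b}^2\overline{a})a^3 +(24\overline{a}^2b^2-16\overline{a}^4 -56\overline{b}^2\overline{a}^2-9\overline{b}^4)a^2+(24\overline{a}^3 -6\overline{b}^2\overline{a})b^2a+3\overline{a}^2b^4\Big],\\ W_3&= -2\Big[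 2bp^5-\overline{b}(q+4a)p^4-b\big((14a+2\overline{a})q+2a^2 +12\overline{a}a -8b^2+2\overline{a}^2+\overline{b}^2\big)p^3 \\ & +\overline{b}\big(4aq^2+(20a^2 +20\overline{a}a-7b^2)q+4a^3+24\overline{a}a^2 +(-24b^2+4\overline{a}^2+3\overline{b}^2)a-\overline{a}b^2\big)p^2 \\ & +b\Big(32\overline{a}aq^2+\big(56\overline{a}a^2+(8\overline{a}^2 +26\overline{b}^2)a-6\overline{a}b^2\big)q+8\overline{a}a^3 +(16\overline{a}^2+26\overline{b}^2)a^2\\ & +(-18\overline{a}b^2 +8\overline{a}^3+2\overline{b}^2\overline{a})a+(-6\overline{a}^2 -\overline{b}^2)b^2\Big)p -\overline{b}\Big(80\overline{a}a^2q^2+4a\big(20\overline{a}a^2 \\ & +(16\overline{a}^2+6\overline{b}^2)a -3\overline{a}b^2\big)q+16\overline{a}a^4 +(32\overline{a}^2+12\overline{b}^2)a^3 +(-28\overline{a}b^2+16\overline{a}^3+16\overline{b}^2\overline{a})a^2 \\ & +(-24\overline{a}^2-\overline{b}^2)b^2a-\overline{a}b^4\Big)\Big], \\ W_2&= 2\Big[\big(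 (3a-\overline{a})q-3b^2 \big)p^4 +b\overline{b}(3q+9a+\overline{a})p^3 +\Big(-2(6a^2+2\overline{a}a-b^2)q^2 -\big(4a^3 \\ & +16\overline{a}a^2 +(-27b^2-4\overline{a}^2+9\overline{b}^2)a +4\overline{a}b^2\big)q+3(b^2-3\overline{b}^2)a^2 +(9\overline{a}b^2-\overline{b}^2\overline{a})a-7b^4\\ & +2\overline{a}^2b^2\Big)p^2 -b\overline{b}\big(28aq^2+(60a^2-5b^2)q+8a^3+20\overline{a}a^2-(19b^2 -12\overline{a}^2)a-5\overline{a}b^2\big)p \\ & +32\overline{a}a^2q^3 +4a\big(12\overline{a}a^2+(4\overline{a}^2+11\overline{b}^2)a -3\overline{a}b^2\big)q^2 +\big(16\overline{a}a^4+(16\overline{a}^2 +44\overline{b}^2)a^3\\ & +(-32\overline{a}b^2+40\overline{b}^2\overline{a})a^2 -(12\overline{a}^2+9\overline{b}^2)b^2a+\overline{a}b^4\big)q +8\overline{b}^2a^4+(-4\overline{a}b^2+20\overline{b}^2\overline{a})a^3 \\ & +\big(-(4\overline{a}^2+15\overline{b}^2)b^2+12\overline{b}^2\overline{a}^2 +3\overline{b}^4\big)a^2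 +(5\overline{a}b^4-15\overline{b}^2\overline{a}b^2)a +2\overline{a}^2b^4\Big],\\ W_1&=2\Big[2b\big(q^2+(3a-\overline{a})q-b^2\big)p^3 -\overline{b}\big(8aq^2+(12a^2 -4\overline{a}a+b^2)q-6b^2a-2\overline{a}b^2\big)p^2\\ & -b\Big(8aq^3+(32a^2 -8\overline{a}a-2b^2)q^2+\big(8a^3+8\overline{a}a^2 +(-20b^2-2\overline{b}^2)a +2\overline{a}b^2\big)q \\ & +(-2b^2+6\overline{b}^2)a^2+(-2\overline{a}b^2 +6\overline{b}^2\overline{a})a+3b^4-\overline{b}^2b^2\Big)p +\overline{b}\Big(32a^2q^3\\ & +4a(12a^2+4\overline{a}a-3b^2)q^2+\big(16a^4 +16\overline{a}a^3+(-32b^2+8\overline{b}^2)a^2 -12\overline{a}b^2a+b^4\big)q\\ & +(-4b^2+4\overline{b}^2)a^3+(-4\overline{a}b^2 +4\overline{b}^2\overline{a})a^2+(5b^4-3\overline{b}^2b^2)a +2\overline{a}b^4\Big)\Big],\\ W_0 & =q^2p^4-2\overline{b}bqp^3 +\big(-8aq^3+(-8a^2+2b^2)q^2+(6b^2+2\overline{b}^2)aq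 -b^4+\overline{b}^2b^2\big)p^2\\ & +2b\overline{b}\big(4aq^2+(-4a^2-b^2)q+(b^2 -\overline{b}^2)a\big)p +16a^2q^4+8a(4a^2-b^2)q^3\\ & +\big(16a^4+(-32b^2+8\overline{b}^2)a^2+b^4\big)q^2 -2a\big((4b^2-4\overline{b}^2)a^2-5b^4+3\overline{b}^2b^2\big)q \\ & +(b-\overline{b})(b+\overline{b})\big((b^2-\overline{b}^2)a^2-b^4\big). \end{align*} (1) Suppose that the segment $[-1,1]$ does not meet $C$. Then $|z-1|+|z+1|$ attains its minimum on $C$, and every $z\in C$ at which this minimum is attained is a root of $F_4=0$. Here $F_4$ is a polynomial of degree at most $6$, of degree exactly $6$ if and only if $W_6\neq0$, and it is not identically zero unless $C$ is one of the ellipses $|z-1|+|z+1|=r$ with $r>2$. (2) Let $D\subset\mathbb C$ be a set whose boundary is a non-degenerate conic $\Gamma$ (for instance a conic domain), let $z_1\ne z_2$ be points of $\mathbb C$, and let \[ s_D(z_1,z_2)=\sup_{z\in\Gamma}\frac{|z_1-z_2|}{|z_1-z|+|z-z_2|} \] (the triangular ratio metric, when $D$ is a domain and $z_1,z_2\in D$).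 Let $A(z)=\frac{2}{z_1-z_2}z-\frac{z_1+z_2}{z_1-z_2}$. If the segment $[z_1,z_2]$ does not meet $\Gamma$, then $C=A(\Gamma)$ is again a non-degenerate conic, and for every equation $c=0$ of $C$ of the above form, with associated polynomial $F_4$, the sum $|z-1|+|z+1|$ attains its minimum over the set $\{z\in C: F_4(z)=0\}$, and every point $\zeta$ of this set at which it is attained satisfies \[ s_D(z_1,z_2)=\sup_{z\in C}\frac{2}{|1-z|+|z+1|}=\frac{2}{|1-\zeta|+|\zeta+1|}. \] If $[z_1,z_2]$ meets $\Gamma$, then $s_D(z_1,z_2)=1$. -/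

import Mathlib

open scoped ComplexConjugate

noncomputable section

namespace Alhazen

/-- The coefficients of a real quadratic equation
`c(z) = conj a * z² + p * z * conj z + a * (conj z)² + conj b * z + b * conj z + q = 0`. -/
structure Conic where
  a : ℂ
  b : ℂ
  p : ℝ
  q : ℝ

/-- The quadratic function `c(z)`. -/
def Conic.eval (K : Conic) (z : ℂ) : ℂ :=
  conj K.a * z ^ 2 + K.p * z * conj z + K.a * conj z ^ 2 + conj K.b * z + K.b * conj z + K.q

/-- The curve `C : c(z) = 0`. -/
def Conic.curve (K : Conic) : Set ℂ := {z | K.eval z = 0}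

/-- The symmetric matrix of the quadratic form of `c` in the homogeneous variables
`(z, conj z, 1)`. -/
def Conic.matrix (K : Conic) : Matrix (Fin 3) (Fin 3) ℂ :=
  !![conj K.a, K.p / 2, conj K.b / 2;
     K.p / 2, K.a, K.b / 2;
     conj K.b / 2, K.b / 2, K.q]

/-- A non-degenerate (real) conic, i.e. an ellipse (possibly a circle), a hyperbola or a parabola:
the determinant of the quadratic form is nonzero (which excludes lines, pairs of lines and single
points), and the curve has a real point (which excludes imaginary ellipses). -/
def Conic.Nondegenerate (K : Conic) : Prop := K.matrix.det ≠ 0 ∧ K.curve.Nonempty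

/-- The coefficient of `z ^ 6` in `F_4`; `ac`, `bc` stand for the complex conjugates of `a`, `b`. -/
def coeffW6 (a ac b bc p q : ℂ) : ℂ :=
  4*ac*(bc*b*p - bc^2*a - ac*b^2)*(p^2 - 4*ac*a)

/-- The coefficient of `z ^ 5` in `F_4`; `ac`, `bc` stand for the complex conjugates of `a`, `b`. -/
def coeffW5 (a ac b bc p q : ℂ) : ℂ :=
  -2*(b*p^5 - bc*(a + ac)*p^4 - b*(4*ac*q + 8*ac*a + bc^2)*p^3 + bc*(8*ac*a*q + 8*ac*a^2 +
    (8*ac^2 + bc^2)*a - 3*ac*b^2)*p^2 + 4*ac*b*(4*ac*a*q + 4*ac*a^2 + 4*bc^2*a + ac*b^2)*p -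
    4*a*ac*bc*(8*ac*a*q + 4*ac*a^2 + (4*ac^2 + 3*bc^2)*a + 3*ac*b^2))

/-- The coefficient of `z ^ 4` in `F_4`; `ac`, `bc` stand for the complex conjugates of `a`, `b`. -/
def coeffW4 (a ac b bc p q : ℂ) : ℂ :=
  -(p^6 - ((4*a + 4*ac)*q + a^2 + 10*ac*a - 9*b^2 + ac^2 + bc^2)*p^4 - 2*b*bc*(2*q + 11*a +
    ac)*p^3 + (16*ac*a*q^2 + 4*(8*ac*a^2 + (8*ac^2 + 2*bc^2)*a - 5*ac*b^2)*q + 8*ac*a^3 +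
    (32*ac^2 + 14*bc^2)*a^2 + (-42*ac*b^2 + 8*ac^3 + 18*bc^2*ac)*a + (-6*ac^2 -
    5*bc^2)*b^2)*p^2 + 2*b*bc*(48*ac*a*q + 44*ac*a^2 + (4*ac^2 + 7*bc^2)*a + ac*b^2)*p -
    64*ac^2*a^2*q^2 - 16*a^2*ac*(4*ac*a + 4*ac^2 + 7*bc^2)*q - 16*ac^2*a^4 - (32*ac^3 +
    56*bc^2*ac)*a^3 + (24*ac^2*b^2 - 16*ac^4 - 56*bc^2*ac^2 - 9*bc^4)*a^2 + (24*ac^3 -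
    6*bc^2*ac)*b^2*a + 3*ac^2*b^4)

/-- The coefficient of `z ^ 3` in `F_4`; `ac`, `bc` stand for the complex conjugates of `a`, `b`. -/
def coeffW3 (a ac b bc p q : ℂ) : ℂ :=
  -2*(2*b*p^5 - bc*(q + 4*a)*p^4 - b*((14*a + 2*ac)*q + 2*a^2 + 12*ac*a - 8*b^2 + 2*ac^2 +
    bc^2)*p^3 + bc*(4*a*q^2 + (20*a^2 + 20*ac*a - 7*b^2)*q + 4*a^3 + 24*ac*a^2 + (-24*b^2 +
    4*ac^2 + 3*bc^2)*a - ac*b^2)*p^2 + b*(32*ac*a*q^2 + (56*ac*a^2 + (8*ac^2 + 26*bc^2)*a -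
    6*ac*b^2)*q + 8*ac*a^3 + (16*ac^2 + 26*bc^2)*a^2 + (-18*ac*b^2 + 8*ac^3 + 2*bc^2*ac)*a +
    (-6*ac^2 - bc^2)*b^2)*p - bc*(80*ac*a^2*q^2 + 4*a*(20*ac*a^2 + (16*ac^2 + 6*bc^2)*a -
    3*ac*b^2)*q + 16*ac*a^4 + (32*ac^2 + 12*bc^2)*a^3 + (-28*ac*b^2 + 16*ac^3 +
    16*bc^2*ac)*a^2 + (-24*ac^2 - bc^2)*b^2*a - ac*b^4))

/-- The coefficient of `z ^ 2` in `F_4`; `ac`, `bc` stand for the complex conjugates of `a`, `b`. -/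
def coeffW2 (a ac b bc p q : ℂ) : ℂ :=
  2*(((3*a - ac)*q - 3*b^2)*p^4 + b*bc*(3*q + 9*a + ac)*p^3 + (-2*(6*a^2 + 2*ac*a - b^2)*q^2
    - (4*a^3 + 16*ac*a^2 + (-27*b^2 - 4*ac^2 + 9*bc^2)*a + 4*ac*b^2)*q + 3*(b^2 -
    3*bc^2)*a^2 + (9*ac*b^2 - bc^2*ac)*a - 7*b^4 + 2*ac^2*b^2)*p^2 - b*bc*(28*a*q^2 +
    (60*a^2 - 5*b^2)*q + 8*a^3 + 20*ac*a^2 - (19*b^2 - 12*ac^2)*a - 5*ac*b^2)*p +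
    32*ac*a^2*q^3 + 4*a*(12*ac*a^2 + (4*ac^2 + 11*bc^2)*a - 3*ac*b^2)*q^2 + (16*ac*a^4 +
    (16*ac^2 + 44*bc^2)*a^3 + (-32*ac*b^2 + 40*bc^2*ac)*a^2 - (12*ac^2 + 9*bc^2)*b^2*a +
    ac*b^4)*q + 8*bc^2*a^4 + (-4*ac*b^2 + 20*bc^2*ac)*a^3 + (-(4*ac^2 + 15*bc^2)*b^2 +
    12*bc^2*ac^2 + 3*bc^4)*a^2 + (5*ac*b^4 - 15*bc^2*ac*b^2)*a + 2*ac^2*b^4)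

/-- The coefficient of `z ^ 1` in `F_4`; `ac`, `bc` stand for the complex conjugates of `a`, `b`. -/
def coeffW1 (a ac b bc p q : ℂ) : ℂ :=
  2*(2*b*(q^2 + (3*a - ac)*q - b^2)*p^3 - bc*(8*a*q^2 + (12*a^2 - 4*ac*a + b^2)*q - 6*b^2*a
    - 2*ac*b^2)*p^2 - b*(8*a*q^3 + (32*a^2 - 8*ac*a - 2*b^2)*q^2 + (8*a^3 + 8*ac*a^2 +
    (-20*b^2 - 2*bc^2)*a + 2*ac*b^2)*q + (-2*b^2 + 6*bc^2)*a^2 + (-2*ac*b^2 + 6*bc^2*ac)*a +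
    3*b^4 - bc^2*b^2)*p + bc*(32*a^2*q^3 + 4*a*(12*a^2 + 4*ac*a - 3*b^2)*q^2 + (16*a^4 +
    16*ac*a^3 + (-32*b^2 + 8*bc^2)*a^2 - 12*ac*b^2*a + b^4)*q + (-4*b^2 + 4*bc^2)*a^3 +
    (-4*ac*b^2 + 4*bc^2*ac)*a^2 + (5*b^4 - 3*bc^2*b^2)*a + 2*ac*b^4))

/-- The coefficient of `z ^ 0` in `F_4`; `ac`, `bc` stand for the complex conjugates of `a`, `b`. -/
def coeffW0 (a ac b bc p q : ℂ) : ℂ :=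
  q^2*p^4 - 2*bc*b*q*p^3 + (-8*a*q^3 + (-8*a^2 + 2*b^2)*q^2 + (6*b^2 + 2*bc^2)*a*q - b^4 +
    bc^2*b^2)*p^2 + 2*b*bc*(4*a*q^2 + (-4*a^2 - b^2)*q + (b^2 - bc^2)*a)*p + 16*a^2*q^4 +
    8*a*(4*a^2 - b^2)*q^3 + (16*a^4 + (-32*b^2 + 8*bc^2)*a^2 + b^4)*q^2 - 2*a*((4*b^2 -
    4*bc^2)*a^2 - 5*b^4 + 3*bc^2*b^2)*q + (b - bc)*(b + bc)*((b^2 - bc^2)*a^2 - b^4)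

/-- The polynomial `F_4 = W_6 z⁶ + W_5 z⁵ + W_4 z⁴ + W_3 z³ + W_2 z² + W_1 z + W_0`
attached to a conic. -/
def Conic.F4 (K : Conic) : Polynomial ℂ :=
  Polynomial.C (coeffW6 K.a (conj K.a) K.b (conj K.b) K.p K.q) * Polynomial.X ^ 6 +
  Polynomial.C (coeffW5 K.a (conj K.a) K.b (conj K.b) K.p K.q) * Polynomial.X ^ 5 +
  Polynomial.C (coeffW4 K.a (conj K.a) K.b (conj K.b) K.p K.q) * Polynomial.X ^ 4 +
  Polynomial.C (coeffW3 K.a (conj K.a) K.b (conj K.b) K.p K.q) * Polynomial.X ^ 3 +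
  Polynomial.C (coeffW2 K.a (conj K.a) K.b (conj K.b) K.p K.q) * Polynomial.X ^ 2 +
  Polynomial.C (coeffW1 K.a (conj K.a) K.b (conj K.b) K.p K.q) * Polynomial.X +
  Polynomial.C (coeffW0 K.a (conj K.a) K.b (conj K.b) K.p K.q)

/-- The sum of the distances to the two foci `1` and `-1`. -/
def focalSum (z : ℂ) : ℝ := ‖z - 1‖ + ‖z + 1‖

/-- The ellipse with foci `1`, `-1` (for `r > 2`). -/
def focalEllipse (r : ℝ) : Set ℂ := {z | focalSum z = r}

/-- The supremum of `|z₁ - z₂| / (|z₁ - z| + |z - z₂|)` over the points `z` of a curve `Γ`. -/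
def ratioSup (Γ : Set ℂ) (z₁ z₂ : ℂ) : ℝ :=
  ⨆ z : Γ, ‖z₁ - z₂‖ / (‖z₁ - z‖ + ‖(z : ℂ) - z₂‖)

/-- The triangular ratio metric `s_D` of a domain `D` of the complex plane. -/
def triangularRatio (D : Set ℂ) (z₁ z₂ : ℂ) : ℝ := ratioSup (frontier D) z₁ z₂

/-- The similarity `A(z) = 2 z / (z₁ - z₂) - (z₁ + z₂) / (z₁ - z₂)`, which sends `z₁`, `z₂`
to `1`, `-1`. -/
def normalizing (z₁ z₂ z : ℂ) : ℂ := 2 / (z₁ - z₂) * z - (z₁ + z₂) / (z₁ - z₂)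

end Alhazen

end

noncomputable section

namespace Alhazen

/-! ### `F_4` as a resultant -/

/-! At a minimum of the focal sum on the conic, Lagrange multipliers make the normal `n` a real
multiple of the focal gradient `g`, the sum of the unit vectors pointing from the foci to `z`. Off
the foci, `g ^ 2 * conj (z ^ 2 - 1)` is real (`focalGrad_sq_mul`), hence so is `n ^ 2 * conj (z ^ 2
- 1)`. With `w = conj z` treated as an independent variable, this and `c = 0` are two polynomial
equations in `z` and `w`; `F_4` is their resultant in `w` (`resultant_eq_zero`).

If `F_4` vanishes identically and `a ≠ 0`, completing the square gives `S ^ 2 = Δ * Y ^ 2`, where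
`Δ` has a simple root because the conic is nondegenerate. Parity of root multiplicities forces both
minors to vanish, and their coefficients say that the conic is confocal to `±1`
(`confocal_of_resultant_eq_zero`). Of these, only ellipses have points but miss `[-1, 1]`. Circles,
`a = 0`, are settled by evaluating `F_4` at well-chosen points.

The ratio is invariant under similarities, and for `±1` it is `2 / focalSum`; its supremum is
therefore attained where the focal sum is minimal. -/

/-- The discriminant of `c` as a quadratic polynomial in `conj z`; on the conic it equals the square
of the normal vector. -/
def discr (a ac b bc p q z : ℂ) : ℂ :=
  (p ^ 2 - 4 * a * ac) * z ^ 2 + (2 * p * b - 4 * a * bc) * z + (b ^ 2 - 4 * a * q)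

/-- The coefficient of `(conj z) ^ 2` in the equation of the points of reflection. -/
def refl2 (a ac b bc p q z : ℂ) : ℂ :=
  (2 * p * b - 4 * a * bc) * z + (b ^ 2 - 4 * a * q) + (p ^ 2 - 4 * a * ac)

/-- The coefficient of `conj z` in the equation of the points of reflection. -/
def refl1 (ac b bc p z : ℂ) : ℂ := -(2 * p * bc - 4 * ac * b) * (z ^ 2 - 1)

/-- The coefficient free of `conj z` in the equation of the points of reflection. -/
def refl0 (a ac b bc p q z : ℂ) : ℂ :=
  -((p ^ 2 - 4 * a * ac) + (bc ^ 2 - 4 * ac * q)) * z ^ 2 - (2 * p * b - 4 * a * bc) * z -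
    (b ^ 2 - 4 * a * q) + (bc ^ 2 - 4 * ac * q)

/-- The first minor of the two quadratic polynomials in `conj z`. -/
def minor0 (a ac b bc p q z : ℂ) : ℂ :=
  refl2 a ac b bc p q z * (ac * z ^ 2 + bc * z + q) - a * refl0 a ac b bc p q z

/-- The second minor of the two quadratic polynomials in `conj z`. -/
def minor1 (a ac b bc p q z : ℂ) : ℂ :=
  refl2 a ac b bc p q z * (p * z + b) - a * refl1 ac b bc p z

/-- The resultant, with respect to `conj z`, of `c` and the equation of the points of
reflection. -/
def resultant (a ac b bc p q z : ℂ) : ℂ :=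
  minor0 a ac b bc p q z ^ 2 - minor1 a ac b bc p q z *
    (refl1 ac b bc p z * (ac * z ^ 2 + bc * z + q) - refl0 a ac b bc p q z * (p * z + b))

theorem sum_coeff_eq_resultant (a ac b bc p q z : ℂ) :
    coeffW6 a ac b bc p q * z ^ 6 + coeffW5 a ac b bc p q * z ^ 5 +
      coeffW4 a ac b bc p q * z ^ 4 + coeffW3 a ac b bc p q * z ^ 3 +
      coeffW2 a ac b bc p q * z ^ 2 + coeffW1 a ac b bc p q * z + coeffW0 a ac b bc p q =
      resultant a ac b bc p q z := by
  simp only [coeffW6, coeffW5, coeffW4, coeffW3, coeffW2, coeffW1, coeffW0, resultant, minor0,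
    minor1, refl2, refl1, refl0]
  ring

theorem Conic.F4_eval (K : Conic) (z : ℂ) :
    K.F4.eval z = resultant K.a (conj K.a) K.b (conj K.b) K.p K.q z := by
  rw [← sum_coeff_eq_resultant]
  simp [Conic.F4]

/-- Elimination of `w`: the two quadratics in `w` yield two equations linear in `w`, the rows of
their Bézout matrix, whose determinant must vanish. -/
theorem resultant_eq_zero {a ac b bc p q z w : ℂ}
    (hc : ac * z ^ 2 + p * z * w + a * w ^ 2 + bc * z + b * w + q = 0)
    (hn : (p * z + 2 * a * w + b) ^ 2 * (w ^ 2 - 1) =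
      (p * w + 2 * ac * z + bc) ^ 2 * (z ^ 2 - 1)) :
    resultant a ac b bc p q z = 0 := by
  have h1 : a * w ^ 2 + (p * z + b) * w + (ac * z ^ 2 + bc * z + q) = 0 := by
    linear_combination hc
  -- Modulo `c`, each squared normal becomes a discriminant, in `z` alone or in `w` alone; the `z ^
  -- 2 * w ^ 2` terms then cancel.
  have h2 : refl2 a ac b bc p q z * w ^ 2 + refl1 ac b bc p z * w + refl0 a ac b bc p q z = 0 := by
    simp only [refl2, refl1, refl0]
    linear_combination hn - 4 * a * (w ^ 2 - 1) * hc + 4 * ac * (z ^ 2 - 1) * hc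
  have h3 : minor1 a ac b bc p q z * w + minor0 a ac b bc p q z = 0 := by
    unfold minor1 minor0
    linear_combination refl2 a ac b bc p q z * h1 - a * h2
  have h4 : minor0 a ac b bc p q z * w + (refl1 ac b bc p z * (ac * z ^ 2 + bc * z + q) -
      refl0 a ac b bc p q z * (p * z + b)) = 0 := by
    unfold minor0
    linear_combination (refl2 a ac b bc p q z * w + refl1 ac b bc p z) * h1 -
      (a * w + (p * z + b)) * h2
  unfold resultant
  linear_combination minor0 a ac b bc p q z * h3 - minor1 a ac b bc p q z * h4

/-- Up to the factor `a`, the resultant is `a * X ^ 2 - (p * z + b) * X * Y + (ac * z ^ 2 + bc * z +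
q) * Y ^ 2` in the minors `X = minor0`, `Y = minor1`; now complete the square. -/
theorem resultant_completed_square (a ac b bc p q z : ℂ) :
    (2 * a * minor0 a ac b bc p q z - (p * z + b) * minor1 a ac b bc p q z) ^ 2 -
      discr a ac b bc p q z * minor1 a ac b bc p q z ^ 2 =
      4 * a ^ 2 * resultant a ac b bc p q z := by
  simp only [discr, resultant, minor0, minor1]
  ring

/-! ### The degree of `F_4` -/

theorem Conic.natDegree_F4_le (K : Conic) : K.F4.natDegree ≤ 6 := by
  unfold Conic.F4
  compute_degree

theorem Conic.natDegree_F4_eq_iff (K : Conic) :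
    K.F4.natDegree = 6 ↔ coeffW6 K.a (conj K.a) K.b (conj K.b) K.p K.q ≠ 0 := by
  have h6 : K.F4.coeff 6 = coeffW6 K.a (conj K.a) K.b (conj K.b) K.p K.q := by
    unfold Conic.F4
    simp
  rw [← h6]
  constructor
  · intro h h0
    have hz : K.F4 = 0 := by
      rw [← Polynomial.leadingCoeff_eq_zero, Polynomial.leadingCoeff, h, h0]
    simp [hz] at h
  · exact fun h => le_antisymm K.natDegree_F4_le (Polynomial.le_natDegree_of_ne_zero h)

/-! ### Real conics -/

theorem Conic.det_matrix (K : Conic) :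
    4 * K.matrix.det = 4 * K.a * conj K.a * K.q - conj K.a * K.b ^ 2 - K.a * conj K.b ^ 2 -
      K.p ^ 2 * K.q + K.p * K.b * conj K.b := by
  rw [Conic.matrix, Matrix.det_fin_three]
  simp
  ring

/-- Half the real gradient of `c`, a normal vector of the curve. -/
def Conic.normal (K : Conic) (z : ℂ) : ℂ := K.p * z + 2 * K.a * conj z + K.b

/-- At a singular point of the curve, `(z, conj z, 1)` lies in the kernel of the matrix; the last
row is Euler's identity. -/
theorem Conic.normal_ne_zero {K : Conic} (hK : K.matrix.det ≠ 0) {z : ℂ} (hz : z ∈ K.curve) :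
    K.normal z ≠ 0 := by
  intro hn
  have hn' : K.p * conj z + 2 * conj K.a * z + conj K.b = 0 := by
    simpa [Conic.normal, map_ofNat] using congrArg conj hn
  change K.eval z = 0 at hz
  unfold Conic.eval at hz
  unfold Conic.normal at hn
  apply hK
  rw [← Matrix.exists_mulVec_eq_zero_iff]
  refine ⟨![z, conj z, 1], fun h => one_ne_zero (congrFun h 2), ?_⟩
  ext i
  fin_cases i <;> simp [Conic.matrix, Matrix.mulVec, dotProduct, Fin.sum_univ_three]
  · linear_combination hn' / 2
  · linear_combination hn / 2
  · linear_combination hz - z * hn' / 2 - conj z * hn / 2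

/-- Since `c` is real-valued, the curve is the zero set of one real function, so a single Lagrange
multiplier suffices. -/
theorem Conic.conj_eval (K : Conic) (z : ℂ) : conj (K.eval z) = K.eval z := by
  simp [Conic.eval]
  ring

theorem Conic.mem_curve_iff_re (K : Conic) (z : ℂ) : z ∈ K.curve ↔ (K.eval z).re = 0 := by
  constructor
  · intro h
    rw [show K.eval z = 0 from h, Complex.zero_re]
  · intro h
    exact Complex.ext h (Complex.conj_eq_iff_im.1 (K.conj_eval z))

theorem Conic.continuous_eval (K : Conic) : Continuous K.eval := by
  unfold Conic.eval
  fun_prop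

theorem Conic.isClosed_curve (K : Conic) : IsClosed K.curve :=
  isClosed_eq K.continuous_eval continuous_const

theorem Conic.hasStrictFDerivAt_re_eval (K : Conic) (z : ℂ) :
    HasStrictFDerivAt (fun w => (K.eval w).re) ((2 : ℝ) • innerSL ℝ (K.normal z)) z := by
  have hid : HasStrictFDerivAt (fun w : ℂ => w) (ContinuousLinearMap.id ℝ ℂ) z :=
    hasStrictFDerivAt_id z
  have hcj : HasStrictFDerivAt (fun w : ℂ => conj w) (Complex.conjCLE : ℂ →L[ℝ] ℂ) z :=
    Complex.conjCLE.hasStrictFDerivAt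
  have h := Complex.reCLM.hasStrictFDerivAt.comp z ((((((hid.mul hid).const_mul (conj K.a)).add
    ((hid.mul hcj).const_mul (K.p : ℂ))).add ((hcj.mul hcj).const_mul K.a)).add
    (hid.const_mul (conj K.b))).add (hcj.const_mul K.b))
  have h' := h.add_const K.q
  refine (h'.congr_fderiv ?_).congr_of_eventuallyEq (Filter.Eventually.of_forall fun w => ?_)
  · ext w
    simp [Conic.normal, Complex.inner]
    ring
  · simp [Conic.eval, pow_two]
    ring

/-! ### The focal sum -/

theorem continuous_focalSum : Continuous focalSum := by
  unfold focalSum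
  fun_prop

/-- Coercivity, which yields a minimum on closed sets that need not be bounded. -/
theorem two_mul_norm_le_focalSum (z : ℂ) : 2 * ‖z‖ ≤ focalSum z := by
  have h := norm_add_le (z - 1) (z + 1)
  rw [show z - 1 + (z + 1) = (2 : ℂ) * z by ring, norm_mul] at h
  simpa [focalSum] using h

theorem two_le_focalSum (z : ℂ) : 2 ≤ focalSum z := by
  have h := norm_sub_le (z + 1) (z - 1)
  rw [show z + 1 - (z - 1) = (2 : ℂ) by ring] at h
  rw [focalSum]
  norm_num at h
  linarith

theorem exists_isMinOn_focalSum {S : Set ℂ} (hS : IsClosed S) (hne : S.Nonempty) :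
    ∃ z ∈ S, IsMinOn focalSum S z := by
  obtain ⟨x, hx⟩ := hne
  refine continuous_focalSum.continuousOn.exists_isMinOn' hS hx ?_
  refine Filter.Eventually.filter_mono inf_le_left ?_
  filter_upwards [(tendsto_norm_cocompact_atTop (E := ℂ)).eventually_ge_atTop
    (focalSum x)] with z hz
  have := two_mul_norm_le_focalSum z
  have := norm_nonneg z
  linarith

/-- The gradient of the focal sum. -/
def focalGrad (z : ℂ) : ℂ := (z - 1) / ‖z - 1‖ + (z + 1) / ‖z + 1‖

theorem hasStrictFDerivAt_norm {z : ℂ} (hz : z ≠ 0) :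
    HasStrictFDerivAt (fun w : ℂ => ‖w‖) (innerSL ℝ (z / ‖z‖)) z := by
  have hn : ‖z‖ ≠ 0 := norm_ne_zero_iff.2 hz
  have h := (hasStrictFDerivAt_norm_sq z).sqrt (pow_ne_zero 2 hn)
  simp only [Real.sqrt_sq (norm_nonneg _)] at h
  refine h.congr_fderiv ?_
  ext w
  simp [Complex.inner]
  field_simp
  ring

theorem hasStrictFDerivAt_focalSum {z : ℂ} (h1 : z ≠ 1) (h2 : z ≠ -1) :
    HasStrictFDerivAt focalSum (innerSL ℝ (focalGrad z)) z := by
  have e1 := (hasStrictFDerivAt_norm (sub_ne_zero.2 h1)).comp z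
    ((hasStrictFDerivAt_id z).sub_const 1)
  have e2 := (hasStrictFDerivAt_norm (z := z + 1) (by rwa [Ne, add_eq_zero_iff_eq_neg])).comp z
    ((hasStrictFDerivAt_id z).add_const 1)
  refine (e1.add e2).congr_fderiv ?_
  rw [focalGrad, map_add]
  rfl

theorem focalGrad_ne_zero {z : ℂ} (hz : z ∉ segment ℝ (-1 : ℂ) 1) : focalGrad z ≠ 0 := by
  intro h
  have h1 : z - 1 ≠ 0 := fun h => hz (by
    rw [sub_eq_zero.1 h]
    exact right_mem_segment ℝ _ _)
  have h2 : z + 1 ≠ 0 := fun h => hz (by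
    rw [add_eq_zero_iff_eq_neg.1 h]
    exact left_mem_segment ℝ _ _)
  have hr : 0 < ‖z - 1‖ := norm_pos_iff.2 h1
  have hs : 0 < ‖z + 1‖ := norm_pos_iff.2 h2
  have hr' : (‖z - 1‖ : ℂ) ≠ 0 := by exact_mod_cast hr.ne'
  have hs' : (‖z + 1‖ : ℂ) ≠ 0 := by exact_mod_cast hs.ne'
  have hrs : (‖z - 1‖ : ℂ) + ‖z + 1‖ ≠ 0 := by exact_mod_cast (add_pos hr hs).ne'
  -- Two unit vectors cancel only if `z` lies between the foci; each focus is weighted by the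
  -- distance to the other one.
  refine hz ⟨‖z - 1‖ / (‖z - 1‖ + ‖z + 1‖), ‖z + 1‖ / (‖z - 1‖ + ‖z + 1‖), by positivity,
    by positivity, by field_simp, ?_⟩
  rw [focalGrad] at h
  generalize ‖z - 1‖ = r at *
  generalize ‖z + 1‖ = s at *
  field_simp at h
  simp only [Complex.real_smul]
  push_cast
  field_simp
  linear_combination -h

theorem focalGrad_sq_mul {z : ℂ} (h1 : z ≠ 1) (h2 : z ≠ -1) :
    focalGrad z ^ 2 * (conj z ^ 2 - 1) = conj (focalGrad z) ^ 2 * (z ^ 2 - 1) := by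
  have hr : (‖z - 1‖ : ℂ) ≠ 0 := by exact_mod_cast norm_ne_zero_iff.2 (sub_ne_zero.2 h1)
  have hs : (‖z + 1‖ : ℂ) ≠ 0 := by
    exact_mod_cast norm_ne_zero_iff.2 (show z + 1 ≠ 0 by rwa [Ne, add_eq_zero_iff_eq_neg])
  have hu : (z - 1) * (conj z - 1) = (‖z - 1‖ : ℂ) ^ 2 := by
    rw [← Complex.mul_conj', map_sub, map_one]
  have hv : (z + 1) * (conj z + 1) = (‖z + 1‖ : ℂ) ^ 2 := by
    rw [← Complex.mul_conj', map_add, map_one]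
  -- The right-hand side is symmetric under exchanging `u, v` with `u', v'`, that is, under
  -- conjugation.
  have key : ∀ u v u' v' r s : ℂ, r ≠ 0 → s ≠ 0 → u * u' = r ^ 2 → v * v' = s ^ 2 →
      (u / r + v / s) ^ 2 * (u' * v') = u * v' + v * u' + 2 * r * s := by
    intro u v u' v' r s hr hs hu hv
    field_simp
    linear_combination (s ^ 2 * u * v' + 2 * r * s * v * v') * hu +
      (r ^ 2 * v * u' + 2 * r ^ 3 * s) * hv
  have k1 := key _ _ _ _ _ _ hr hs hu hv
  have k2 := key _ _ _ _ _ _ hr hs ((mul_comm _ _).trans hu) ((mul_comm _ _).trans hv)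
  simp only [focalGrad, map_add, map_div₀, map_sub, map_one, Complex.conj_ofReal]
  linear_combination k1 - k2

/-- A minimum point of the focal sum on a conic is a point of reflection. -/
theorem Conic.isRoot_F4_of_isMinOn {K : Conic} (hK : K.matrix.det ≠ 0)
    (hd : Disjoint (segment ℝ (-1 : ℂ) 1) K.curve) {z : ℂ} (hz : z ∈ K.curve)
    (hmin : IsMinOn focalSum K.curve z) : K.F4.IsRoot z := by
  have hseg : z ∉ segment ℝ (-1 : ℂ) 1 := fun h => Set.disjoint_left.1 hd h hz
  have h1 : z ≠ 1 := fun h => hseg (h ▸ right_mem_segment ℝ _ _)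
  have h2 : z ≠ -1 := fun h => hseg (h ▸ left_mem_segment ℝ _ _)
  have hset : {w | (K.eval w).re = (K.eval z).re} = K.curve := by
    ext w
    rw [Set.mem_ofPred_eq, (K.mem_curve_iff_re z).1 hz, K.mem_curve_iff_re]
  have hext : IsLocalExtrOn focalSum {w | (K.eval w).re = (K.eval z).re} z := by
    rw [hset]
    exact Or.inl hmin.localize
  obtain ⟨s, t, hst, h⟩ := hext.exists_multipliers_of_hasStrictFDerivAt_1d
    (K.hasStrictFDerivAt_re_eval z) (hasStrictFDerivAt_focalSum h1 h2)
  have hlin : (2 * s) • K.normal z + t • focalGrad z = 0 := by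
    refine ext_inner_right ℝ fun v => ?_
    have hv := DFunLike.congr_fun h v
    simp only [add_apply, smul_apply, innerSL_apply_apply, zero_apply, smul_eq_mul] at hv
    rw [inner_add_left, inner_smul_left, inner_smul_left, inner_zero_left]
    simp only [conj_trivial]
    linear_combination hv
  have hn := K.normal_ne_zero hK hz
  have hg := focalGrad_ne_zero hseg
  -- With `s = 0` the multiplier relation would give a vanishing focal gradient, impossible off the
  -- segment.
  have hs : s ≠ 0 := by
    rintro rfl
    have ht : t ≠ 0 := fun ht => hst (by rw [ht]; rfl)
    simp [ht, hg] at hlin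
  have hn' : K.normal z = ((-(t / (2 * s)) : ℝ) : ℂ) * focalGrad z := by
    have : (s : ℂ) ≠ 0 := by exact_mod_cast hs
    simp only [Complex.real_smul] at hlin
    push_cast at hlin ⊢
    field_simp
    linear_combination hlin
  rw [Polynomial.IsRoot.def, K.F4_eval]
  refine resultant_eq_zero (w := conj z) hz ?_
  have e1 : K.p * z + 2 * K.a * conj z + K.b = K.normal z := rfl
  have e2 : K.p * conj z + 2 * conj K.a * z + conj K.b = conj (K.normal z) := by
    simp [Conic.normal, map_ofNat]
  rw [e1, e2, hn', map_mul, Complex.conj_ofReal]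
  linear_combination ((-(t / (2 * s)) : ℝ) : ℂ) ^ 2 * focalGrad_sq_mul h1 h2

/-! ### Vanishing of `F_4` -/

/-- If `Y ≠ 0`, the multiplicity of `r` is even on the left and odd on the right. -/
theorem eq_zero_of_sq_eq_mul_sq {S Y Δ : Polynomial ℂ} {r : ℂ} (hr : Δ.IsRoot r)
    (hr' : ¬ (Polynomial.derivative Δ).IsRoot r) (h : S ^ 2 = Δ * Y ^ 2) : Y = 0 := by
  by_contra hY
  have hΔ : Δ ≠ 0 := by
    rintro rfl
    simp at hr'
  have hm : Δ.rootMultiplicity r = 1 := by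
    have h1 := (Polynomial.rootMultiplicity_pos hΔ).2 hr
    have h2 := mt (Polynomial.one_lt_rootMultiplicity_iff_isRoot hΔ).1 fun h => hr' h.2
    omega
  have hne : Δ * Y ^ 2 ≠ 0 := mul_ne_zero hΔ (pow_ne_zero 2 hY)
  have hS : S ^ 2 ≠ 0 := h ▸ hne
  have hS0 : S ≠ 0 := fun h0 => hS (by simp [h0])
  have h3 := congrArg (Polynomial.rootMultiplicity r) h
  rw [Polynomial.rootMultiplicity_mul hne, pow_two, pow_two,
    Polynomial.rootMultiplicity_mul (mul_ne_zero hS0 hS0),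
    Polynomial.rootMultiplicity_mul (mul_ne_zero hY hY), hm] at h3
  omega

/-- The case `A = 0` matters: the leading coefficient `p ^ 2 - 4 * a * ac` of `discr` vanishes for
parabolas. -/
theorem exists_simple_root {A B C : ℂ} (h : B ^ 2 - 4 * A * C ≠ 0) :
    ∃ r, A * r ^ 2 + B * r + C = 0 ∧ 2 * A * r + B ≠ 0 := by
  by_cases hA : A = 0
  · subst hA
    have hB : B ≠ 0 := by
      rintro rfl
      simp at h
    exact ⟨-C / B, by field_simp; ring, by simpa using hB⟩
  · obtain ⟨s, hs⟩ := IsAlgClosed.exists_pow_nat_eq (B ^ 2 - 4 * A * C) (n := 2) two_pos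
    refine ⟨(s - B) / (2 * A), ?_, ?_⟩
    · field_simp
      linear_combination hs
    · intro h0
      field_simp at h0
      have hs0 : s = 0 := by linear_combination h0
      apply h
      rw [← hs, hs0]
      ring

theorem minor_eq_zero {a ac b bc p q : ℂ} (ha : a ≠ 0)
    (hdet : 4 * a * ac * q - ac * b ^ 2 - a * bc ^ 2 - p ^ 2 * q + p * b * bc ≠ 0)
    (h : ∀ z, resultant a ac b bc p q z = 0) (z : ℂ) :
    minor1 a ac b bc p q z = 0 ∧ minor0 a ac b bc p q z = 0 := by
  have hΔ : (2 * p * b - 4 * a * bc) ^ 2 - 4 * (p ^ 2 - 4 * a * ac) * (b ^ 2 - 4 * a * q) ≠ 0 := by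
    -- The discriminant of `discr` in `z` is a multiple of the determinant of the conic.
    have e : (2 * p * b - 4 * a * bc) ^ 2 - 4 * (p ^ 2 - 4 * a * ac) * (b ^ 2 - 4 * a * q) =
        -16 * a * (4 * a * ac * q - ac * b ^ 2 - a * bc ^ 2 - p ^ 2 * q + p * b * bc) := by ring
    rw [e]
    exact mul_ne_zero (mul_ne_zero (by norm_num) ha) hdet
  obtain ⟨r, hr, hr'⟩ := exists_simple_root hΔ
  let Δ : Polynomial ℂ := .C (p ^ 2 - 4 * a * ac) * .X ^ 2 + .C (2 * p * b - 4 * a * bc) * .X +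
    .C (b ^ 2 - 4 * a * q)
  let A2 : Polynomial ℂ := .C (2 * p * b - 4 * a * bc) * .X +
    .C ((b ^ 2 - 4 * a * q) + (p ^ 2 - 4 * a * ac))
  let A1 : Polynomial ℂ := .C (-(2 * p * bc - 4 * ac * b)) * (.X ^ 2 - 1)
  let A0 : Polynomial ℂ := .C (-((p ^ 2 - 4 * a * ac) + (bc ^ 2 - 4 * ac * q))) * .X ^ 2 -
    .C (2 * p * b - 4 * a * bc) * .X - .C (b ^ 2 - 4 * a * q) + .C (bc ^ 2 - 4 * ac * q)
  let c1 : Polynomial ℂ := .C p * .X + .C b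
  let Y : Polynomial ℂ := A2 * c1 - .C a * A1
  let X : Polynomial ℂ := A2 * (.C ac * .X ^ 2 + .C bc * .X + .C q) - .C a * A0
  have hYe : ∀ w, Y.eval w = minor1 a ac b bc p q w := fun w => by
    simp only [Y, A2, A1, c1, minor1, refl2, refl1, Polynomial.eval_add,
      Polynomial.eval_sub, Polynomial.eval_mul,
      Polynomial.eval_C, Polynomial.eval_X, Polynomial.eval_pow, Polynomial.eval_one]
    ring
  have hXe : ∀ w, X.eval w = minor0 a ac b bc p q w := fun w => by
    simp only [X, A2, A0, minor0, refl2, refl0, Polynomial.eval_add,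
      Polynomial.eval_sub, Polynomial.eval_mul,
      Polynomial.eval_C, Polynomial.eval_X, Polynomial.eval_pow]
    ring
  have hΔe : ∀ w, Δ.eval w = discr a ac b bc p q w := fun w => by
    simp [Δ, discr]
  have hsq : (.C (2 * a) * X - c1 * Y) ^ 2 = Δ * Y ^ 2 := by
    refine Polynomial.funext fun w => ?_
    have hc := resultant_completed_square a ac b bc p q w
    rw [h w] at hc
    have hc1 : c1.eval w = p * w + b := by simp [c1]
    simp only [Polynomial.eval_pow, Polynomial.eval_sub, Polynomial.eval_mul, Polynomial.eval_C,
      hYe, hXe, hΔe, hc1]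
    linear_combination hc
  have hY : Y = 0 := by
    refine eq_zero_of_sq_eq_mul_sq (r := r) ?_ ?_ hsq
    · rw [Polynomial.IsRoot.def, hΔe]
      exact hr
    · intro h0
      apply hr'
      rw [← h0]
      simp [Δ, -map_sub, -map_mul, -map_pow]
      ring
  have hX : X = 0 := by
    rw [hY] at hsq
    simpa [ha] using hsq
  rw [← hYe, ← hXe, hX, hY]
  simp

/-- For `a ≠ 0`, the polynomial `F_4` vanishes only for the conics confocal to `±1`. -/
theorem confocal_of_resultant_eq_zero {a b : ℂ} {p q : ℝ} (ha : a ≠ 0)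
    (hdet : 4 * a * conj a * q - conj a * b ^ 2 - a * conj b ^ 2 - (p : ℂ) ^ 2 * q +
      p * b * conj b ≠ 0)
    (h : ∀ z, resultant a (conj a) b (conj b) p q z = 0) :
    b = 0 ∧ conj a = a ∧ 4 * a * q = (p : ℂ) ^ 2 - 4 * a * conj a := by
  have hac : conj a ≠ 0 := by simpa using ha
  have hm := minor_eq_zero ha hdet h
  have hm0 : ∀ z, minor0 a (conj a) b (conj b) p q z = 0 := fun z => (hm z).2
  have hm1 : ∀ z, minor1 a (conj a) b (conj b) p q z = 0 := fun z => (hm z).1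
  simp only [minor0, minor1, refl0, refl1, refl2] at hm0 hm1
  -- Finite differences extract the coefficients of the minors, here the cubic one. Once it
  -- vanishes, `refl2` reduces to the constant `T` below.
  have x3 : (2 * p * b - 4 * a * conj b) * conj a = 0 := by
    linear_combination (hm0 2 - 3 * hm0 1 + 3 * hm0 0 - hm0 (-1)) / 6
  have hE : 2 * p * b = 4 * a * conj b := sub_eq_zero.1 ((mul_eq_zero.1 x3).resolve_right hac)
  have hE' : 2 * p * conj b = 4 * conj a * b := by
    have := congrArg conj hE
    simpa [map_ofNat] using this
  obtain ⟨T, hT⟩ : ∃ T, T = (b ^ 2 - 4 * a * q) + ((p : ℂ) ^ 2 - 4 * a * conj a) := ⟨_, rfl⟩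
  have y1 : T * p = 0 := by
    rw [hT]
    linear_combination (hm1 1 - hm1 (-1)) / 2 - b * hE
  have y0 : T * b = 0 := by
    rw [hT] at y1 ⊢
    linear_combination hm1 1 - (p + b) * hE - y1
  have x2 : T * conj a + a * (((p : ℂ) ^ 2 - 4 * a * conj a) + (conj b ^ 2 - 4 * conj a * q)) = 0 := by
    rw [hT]
    linear_combination (hm0 1 + hm0 (-1) - 2 * hm0 0) / 2 - conj b * hE
  have x0 : T * q + a * ((b ^ 2 - 4 * a * q) - (conj b ^ 2 - 4 * conj a * q)) = 0 := by
    rw [hT]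
    linear_combination hm0 0
  -- Otherwise `p = b = 0`, and the two remaining relations force `conj a = -q`, which makes `T`
  -- vanish after all.
  have hT0 : T = 0 := by
    by_contra hne
    have hp : (p : ℂ) = 0 := (mul_eq_zero.1 y1).resolve_left hne
    have hb : b = 0 := (mul_eq_zero.1 y0).resolve_left hne
    simp only [hp, hb, map_zero] at hT x2 x0 hdet
    have hq : (q : ℂ) ≠ 0 := by
      intro hq
      simp [hq] at hdet
    have h1 : a + conj a + 2 * q = 0 := by
      have : (4 * a * conj a) * (a + conj a + 2 * q) = 0 := by
        rw [hT] at x2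
        linear_combination -x2
      exact (mul_eq_zero.1 this).resolve_left (mul_ne_zero (mul_ne_zero (by norm_num) ha) hac)
    have h2 : a + q = 0 := by
      have : (-4 * a * q) * (a + q) = 0 := by
        rw [hT] at x0
        linear_combination x0
      exact (mul_eq_zero.1 this).resolve_left (mul_ne_zero (mul_ne_zero (by norm_num) ha) hq)
    apply hne
    rw [hT]
    linear_combination (-4 * a) * h1 + 4 * a * h2
  rw [hT0] at hT
  have hb : b = 0 := by
    by_contra hb
    have hD : (p : ℂ) ^ 2 - 4 * a * conj a = 0 := by
      have : ((p : ℂ) ^ 2 - 4 * a * conj a) * b = 0 := by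
        linear_combination p / 2 * hE + a * hE'
      exact (mul_eq_zero.1 this).resolve_right hb
    apply hdet
    have : 4 * a * (4 * a * conj a * q - conj a * b ^ 2 - a * conj b ^ 2 - (p : ℂ) ^ 2 * q +
        p * b * conj b) = 0 := by
      linear_combination (-((2 * p * b - 4 * a * conj b) / 4)) * hE +
        (b ^ 2 - 4 * a * q) * hD
    exact (mul_eq_zero.1 this).resolve_left (mul_ne_zero (by norm_num) ha)
  subst hb
  have h4 : 4 * a * q = (p : ℂ) ^ 2 - 4 * a * conj a := by linear_combination hT
  have hq : (q : ℂ) ≠ 0 := by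
    intro hq
    simp [hq] at hdet
  refine ⟨rfl, ?_, h4⟩
  have h5 : 4 * conj a * q = (p : ℂ) ^ 2 - 4 * conj a * a := by
    simpa [map_ofNat] using congrArg conj h4
  have h6 : 4 * (q : ℂ) * (conj a - a) = 0 := by linear_combination h5 - h4
  exact sub_eq_zero.1 ((mul_eq_zero.1 h6).resolve_left (mul_ne_zero (by norm_num) hq))

/-- For a circle, `F_4` does not vanish identically. -/
theorem exists_resultant_ne_zero_of_circle {b bc p q : ℂ} (hdet : p * b * bc - p ^ 2 * q ≠ 0)
    (hbc : b = p → bc = p) (hbc' : b = -p → bc = -p) :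
    ∃ z, resultant 0 0 b bc p q z ≠ 0 := by
  by_contra! h
  have hp : p ≠ 0 := by
    rintro rfl
    simp at hdet
  -- At the centre `-b / p` the resultant is a square up to a power of `p`. It leaves only the
  -- centres `±1`.
  have h1 : (p ^ 2 - b ^ 2) * (p * b * bc - p ^ 2 * q) = 0 := by
    have e : ((p ^ 2 - b ^ 2) * (p * b * bc - p ^ 2 * q)) ^ 2 =
        p ^ 4 * resultant 0 0 b bc p q (-b / p) := by
      simp only [resultant, minor0, minor1, refl0, refl1, refl2]
      field_simp
      ring
    rwa [h, mul_zero, sq_eq_zero_iff] at e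
  have h2 : (b - p) * (b + p) = 0 := by
    linear_combination -(mul_eq_zero.1 h1).resolve_right hdet
  rcases mul_eq_zero.1 h2 with hb | hb
  · have hb := sub_eq_zero.1 hb
    rw [hbc hb, hb] at h hdet
    have e0 := h 0
    have e1 := h 1
    simp only [resultant, minor0, minor1, refl0, refl1, refl2] at e0 e1
    -- Both values contain the factor `q - p`, with cofactors whose combination no longer involves
    -- `q`.
    have e2 : p ^ 3 * (p * p * p - p ^ 2 * q) = 0 := by
      linear_combination e0 / 12 - e1 / 48
    exact mul_ne_zero (pow_ne_zero 3 hp) hdet e2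
  · have hb := eq_neg_of_add_eq_zero_left hb
    rw [hbc' hb, hb] at h hdet
    have e0 := h 0
    have e1 := h (-1)
    simp only [resultant, minor0, minor1, refl0, refl1, refl2] at e0 e1
    have e2 : p ^ 3 * (p * -p * -p - p ^ 2 * q) = 0 := by
      linear_combination e0 / 12 - e1 / 48
    exact mul_ne_zero (pow_ne_zero 3 hp) hdet e2

/-- A conic confocal to `±1` which does not meet `[-1, 1]` is an ellipse with foci `±1`. -/
theorem Conic.curve_eq_focalEllipse {K : Conic} {A : ℝ} {α : ℝ} (hα : α ≠ 0) (ha : K.a = α)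
    (hb : K.b = 0) (hp : K.p = 2 * α * (1 - 2 * A)) (hq : K.q = 4 * α * A * (A - 1))
    (hA0 : A ≠ 0) (hne : K.curve.Nonempty)
    (hd : Disjoint (segment ℝ (-1 : ℂ) 1) K.curve) :
    ∃ r : ℝ, 2 < r ∧ K.curve = focalEllipse r := by
  -- This is the confocal family `x² / A + y² / (A - 1) = 1` with denominators cleared.
  have hmem : ∀ z : ℂ, z ∈ K.curve ↔ (A - 1) * z.re ^ 2 + A * z.im ^ 2 = A * (A - 1) := by
    intro z
    rw [K.mem_curve_iff_re]
    have : (K.eval z).re =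
        -4 * α * ((A - 1) * z.re ^ 2 + A * z.im ^ 2 - A * (A - 1)) := by
      rw [Conic.eval, ha, hb, hp, hq]
      simp [pow_two]
      ring
    rw [this, mul_eq_zero, sub_eq_zero]
    exact or_iff_right (mul_ne_zero (by norm_num) hα)
  have hA1 : 1 < A := by
    by_contra! hA
    -- For `A < 0` the curve is empty; for `0 < A ≤ 1` it meets the segment at `√A`.
    rcases lt_or_gt_of_ne hA0 with h0 | h0
    · obtain ⟨z, hz⟩ := hne
      rw [hmem] at hz
      nlinarith [sq_nonneg z.re, sq_nonneg z.im]
    · have hs : √A ≤ 1 := Real.sqrt_le_one.2 hA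
      have hs0 := Real.sqrt_nonneg A
      refine Set.disjoint_left.1 hd (?_ : ((√A : ℝ) : ℂ) ∈ _) ?_
      · refine ⟨(1 - √A) / 2, (1 + √A) / 2, by linarith, by linarith, by ring, ?_⟩
        simp only [Complex.real_smul]
        push_cast
        ring
      · rw [hmem]
        simp [Real.sq_sqrt h0.le]
        ring
  have hs1 : 1 < √A := by rwa [Real.lt_sqrt zero_le_one, one_pow]
  have hsA : √A ^ 2 = A := Real.sq_sqrt (by linarith)
  refine ⟨2 * √A, by linarith, ?_⟩
  ext z
  rw [hmem]
  change _ ↔ focalSum z = _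
  rw [focalSum]
  have hu : ‖z - 1‖ ^ 2 = (z.re - 1) ^ 2 + z.im ^ 2 := by
    rw [Complex.sq_norm, Complex.normSq_apply]
    simp
    ring
  have hv : ‖z + 1‖ ^ 2 = (z.re + 1) ^ 2 + z.im ^ 2 := by
    rw [Complex.sq_norm, Complex.normSq_apply]
    simp
    ring
  have hu0 := norm_nonneg (z - 1)
  have hv0 := norm_nonneg (z + 1)
  generalize ‖z - 1‖ = u at *
  generalize ‖z + 1‖ = v at *
  generalize √A = s at *
  have hs0 : 0 < s := by linarith
  subst hsA
  constructor
  · intro h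
    have hx : |z.re| ≤ s := by
      apply abs_le_of_sq_le_sq _ hs0.le
      nlinarith [sq_nonneg z.im, mul_nonneg (sq_nonneg s) (sq_nonneg z.im)]
    have hx1 := abs_le.1 hx
    have hsx : |z.re / s| ≤ 1 := by
      rw [abs_div, abs_of_pos hs0]
      exact (div_le_one hs0).2 hx
    have hsx1 := abs_le.1 hsx
    -- The focal distances on an ellipse are affine in the abscissa; `|z.re| ≤ s` and `1 < s` make
    -- them nonnegative.
    have e1 : u = s - z.re / s := by
      rw [← sq_eq_sq₀ hu0 (by linarith), hu]
      field_simp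
      linear_combination h
    have e2 : v = s + z.re / s := by
      rw [← sq_eq_sq₀ hv0 (by linarith), hv]
      field_simp
      linear_combination h
    rw [e1, e2]
    ring
  · intro h
    have h1 : s * (v - u) = 2 * z.re := by
      linear_combination (hv - hu - (v - u) * h) / 2
    have h2 : s * v = s ^ 2 + z.re := by linear_combination (h1 + s * h) / 2
    linear_combination (-(s ^ 2)) * hv + (s * v + s ^ 2 + z.re) * h2

theorem Conic.F4_ne_zero {K : Conic} (hK : K.Nondegenerate)
    (hd : Disjoint (segment ℝ (-1 : ℂ) 1) K.curve)
    (hell : ∀ r : ℝ, 2 < r → K.curve ≠ focalEllipse r) : K.F4 ≠ 0 := by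
  intro hF
  have hres : ∀ z, resultant K.a (conj K.a) K.b (conj K.b) K.p K.q z = 0 := fun z => by
    rw [← K.F4_eval, hF, Polynomial.eval_zero]
  have hdet := mul_ne_zero (by norm_num : (4 : ℂ) ≠ 0) hK.1
  rw [K.det_matrix] at hdet
  by_cases ha : K.a = 0
  · simp only [ha, map_zero] at hres hdet
    obtain ⟨z, hz⟩ := exists_resultant_ne_zero_of_circle (b := K.b) (bc := conj K.b) (p := K.p)
      (q := K.q) (fun h => hdet (by linear_combination h)) (fun h => by simp [h])
      (fun h => by simp [h])
    exact hz (hres z)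
  · obtain ⟨hb, hca, h4⟩ := confocal_of_resultant_eq_zero ha hdet hres
    obtain ⟨α, hα⟩ := Complex.conj_eq_iff_real.1 hca
    have hα0 : α ≠ 0 := by
      rintro rfl
      exact ha (by simpa using hα)
    rw [hα, Complex.conj_ofReal] at h4
    have h4' : 4 * α * K.q = K.p ^ 2 - 4 * α * α := by exact_mod_cast h4
    -- This value of `A` solves `p = 2 * α * (1 - 2 * A)`.
    have hA0 : (2 * α - K.p) / (4 * α) ≠ 0 := by
      intro h0
      have hp : K.p = 2 * α := by
        field_simp at h0
        linarith
      have hq : K.q = 0 := by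
        rw [hp] at h4'
        have : 4 * α * K.q = 0 := by linear_combination h4'
        exact (mul_eq_zero.1 this).resolve_left (mul_ne_zero four_ne_zero hα0)
      apply hdet
      simp [hb, hq]
    obtain ⟨r, hr, h⟩ := Conic.curve_eq_focalEllipse (A := (2 * α - K.p) / (4 * α)) hα0 hα hb
      (by field_simp; ring) (by field_simp; linear_combination h4') hA0 hK.2 hd
    exact hell r hr h

/-! ### The supremum of the ratio -/

/-- The pull-back of a conic under `w ↦ m * w + s`. -/
def Conic.affine (G : Conic) (m s : ℂ) : Conic where
  a := G.a * conj m ^ 2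
  b := conj m * G.normal s
  p := G.p * Complex.normSq m
  q := (G.eval s).re

theorem Conic.affine_eval (G : Conic) (m s w : ℂ) :
    (G.affine m s).eval w = G.eval (m * w + s) := by
  have h : (((G.eval s).re : ℝ) : ℂ) = G.eval s := Complex.conj_eq_iff_re.1 (G.conj_eval s)
  rw [Conic.eval, Conic.affine]
  simp only [h]
  simp only [Complex.ofReal_mul, ← Complex.mul_conj, Conic.normal, Conic.eval, map_add,
    map_mul, map_pow, Complex.conj_conj, Complex.conj_ofReal, map_ofNat]
  ring

/-- The substitution acts on `(z, conj z, 1)` by a triangular matrix of determinant `m * conj m`. -/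
theorem Conic.det_affine (G : Conic) (m s : ℂ) :
    (G.affine m s).matrix.det = (m * conj m) ^ 2 * G.matrix.det := by
  have h : (((G.eval s).re : ℝ) : ℂ) = G.eval s := Complex.conj_eq_iff_re.1 (G.conj_eval s)
  rw [← mul_right_inj' (by norm_num : (4 : ℂ) ≠ 0), mul_left_comm, Conic.det_matrix, Conic.det_matrix,
    Conic.affine]
  simp only [h]
  simp only [Complex.ofReal_mul, ← Complex.mul_conj, Conic.normal, Conic.eval, map_add,
    map_mul, map_pow, Complex.conj_conj, Complex.conj_ofReal, map_ofNat]
  ring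

theorem normalizing_eq_iff {z₁ z₂ : ℂ} (h : z₁ ≠ z₂) (z w : ℂ) :
    normalizing z₁ z₂ z = w ↔ z = (z₁ - z₂) / 2 * w + (z₁ + z₂) / 2 := by
  have h0 := sub_ne_zero.2 h
  rw [normalizing]
  constructor
  · rintro rfl
    field_simp
    ring
  · rintro rfl
    field_simp
    ring

theorem image_normalizing {z₁ z₂ : ℂ} (h : z₁ ≠ z₂) (S : Set ℂ) :
    normalizing z₁ z₂ '' S = {w | (z₁ - z₂) / 2 * w + (z₁ + z₂) / 2 ∈ S} := by
  ext w
  simp only [Set.mem_image, Set.mem_ofPred_eq, normalizing_eq_iff h, exists_eq_right]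

theorem Conic.exists_image_normalizing {z₁ z₂ : ℂ} (h : z₁ ≠ z₂) {G : Conic}
    (hG : G.Nondegenerate) :
    ∃ K : Conic, K.Nondegenerate ∧ K.curve = normalizing z₁ z₂ '' G.curve := by
  have hm : (z₁ - z₂) / 2 ≠ 0 := div_ne_zero (sub_ne_zero.2 h) two_ne_zero
  have hc : (G.affine ((z₁ - z₂) / 2) ((z₁ + z₂) / 2)).curve =
      normalizing z₁ z₂ '' G.curve := by
    ext w
    rw [image_normalizing h]
    exact Eq.congr_left (G.affine_eval _ _ w)
  refine ⟨_, ⟨?_, hc ▸ hG.2.image _⟩, hc⟩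
  rw [Conic.det_affine]
  exact mul_ne_zero (pow_ne_zero 2 (mul_ne_zero hm ((map_ne_zero _).2 hm))) hG.1

theorem disjoint_image_normalizing {z₁ z₂ : ℂ} (h : z₁ ≠ z₂) {S : Set ℂ}
    (hd : Disjoint (segment ℝ z₁ z₂) S) :
    Disjoint (segment ℝ (-1 : ℂ) 1) (normalizing z₁ z₂ '' S) := by
  rw [image_normalizing h, Set.disjoint_left]
  rintro _ ⟨s, t, hs, ht, hst, rfl⟩ hw
  refine Set.disjoint_left.1 hd ?_ hw
  refine ⟨t, s, ht, hs, by rwa [add_comm], ?_⟩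
  have hst' : (s : ℂ) = 1 - t := by
    rw [← Complex.ofReal_one, ← hst]
    simp
  simp only [Complex.real_smul, hst']
  ring

theorem ratioSup_image_normalizing {z₁ z₂ : ℂ} (h : z₁ ≠ z₂) (S : Set ℂ) :
    ratioSup (normalizing z₁ z₂ '' S) 1 (-1) = ratioSup S z₁ z₂ := by
  have h0 := sub_ne_zero.2 h
  have hn : ‖z₁ - z₂‖ ≠ 0 := norm_ne_zero_iff.2 h0
  have hinj : Function.Injective (normalizing z₁ z₂) := fun x y hxy => by
    rw [(normalizing_eq_iff h x _).1 hxy, ← (normalizing_eq_iff h y _).1 rfl]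
  rw [ratioSup, ratioSup, ← (Equiv.Set.image _ S hinj).iSup_comp]
  refine iSup_congr fun z => ?_
  have e1 : 1 - normalizing z₁ z₂ z = 2 * (z₁ - z) / (z₁ - z₂) := by
    rw [normalizing]
    field_simp
    ring
  have e2 : normalizing z₁ z₂ z - -1 = 2 * (z - z₂) / (z₁ - z₂) := by
    rw [normalizing]
    field_simp
    ring
  simp only [Equiv.Set.image_apply]
  rw [e1, e2, norm_div, norm_div, norm_mul, norm_mul, show ((1 : ℂ) - -1) = 2 by norm_num,
    ← add_div, ← mul_add, div_div_eq_mul_div, mul_div_mul_left _ _ (by simp)]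

/-- The triangle inequality bounds the ratio by `1`, with equality on the segment. -/
theorem ratioSup_eq_one {z₁ z₂ : ℂ} (h : z₁ ≠ z₂) {S : Set ℂ}
    (hd : ¬ Disjoint (segment ℝ z₁ z₂) S) :
    ratioSup S z₁ z₂ = 1 := by
  obtain ⟨z, hz, hzS⟩ := Set.not_disjoint_iff.1 hd
  have hn : 0 < ‖z₁ - z₂‖ := norm_pos_iff.2 (sub_ne_zero.2 h)
  have hle : ∀ w : ℂ, ‖z₁ - z₂‖ / (‖z₁ - w‖ + ‖w - z₂‖) ≤ 1 := fun w =>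
    div_le_one_of_le₀ (norm_sub_le_norm_sub_add_norm_sub _ _ _) (by positivity)
  have : Nonempty S := ⟨⟨z, hzS⟩⟩
  refine le_antisymm (ciSup_le fun w => hle w) ?_
  refine le_trans (le_of_eq ?_) (le_ciSup (f := fun w : S => ‖z₁ - z₂‖ / (‖z₁ - w‖ + ‖(w : ℂ) - z₂‖))
    ⟨1, Set.forall_mem_range.2 fun w => hle w⟩ ⟨z, hzS⟩)
  have hd := dist_add_dist_of_mem_segment hz
  simp only [dist_eq_norm] at hd
  rw [hd, div_self hn.ne']

theorem ratioSup_eq_of_isMinOn {S : Set ℂ} {ζ : ℂ} (hζ : ζ ∈ S) (hmin : IsMinOn focalSum S ζ) :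
    ratioSup S 1 (-1) = 2 / (‖1 - ζ‖ + ‖ζ + 1‖) := by
  have hf : ∀ z : ℂ, ‖(1 : ℂ) - -1‖ / (‖1 - z‖ + ‖z - -1‖) = 2 / focalSum z := fun z => by
    rw [focalSum, norm_sub_rev 1 z, show ((1 : ℂ) - -1) = 2 by norm_num]
    simp
  have hle : ∀ z : S, ‖(1 : ℂ) - -1‖ / (‖1 - (z : ℂ)‖ + ‖(z : ℂ) - -1‖) ≤ 2 / focalSum ζ :=
    fun z => by
      rw [hf]
      exact div_le_div_of_nonneg_left zero_le_two
        (lt_of_lt_of_le two_pos (two_le_focalSum ζ)) (hmin z.2)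
  have : Nonempty S := ⟨⟨ζ, hζ⟩⟩
  rw [norm_sub_rev 1 ζ]
  change _ = 2 / focalSum ζ
  refine le_antisymm (ciSup_le hle) ?_
  rw [← hf]
  exact le_ciSup (f := fun z : S => ‖(1 : ℂ) - -1‖ / (‖1 - (z : ℂ)‖ + ‖(z : ℂ) - -1‖))
    ⟨_, Set.forall_mem_range.2 hle⟩ ⟨ζ, hζ⟩

end Alhazen

end

theorem theorem4p2 :
    -- the minimum of the focal sum on a conic missing `[-1, 1]`
    (∀ K : Alhazen.Conic, K.Nondegenerate → Disjoint (segment ℝ (-1 : ℂ) 1) K.curve →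
      (∃ z ∈ K.curve, IsMinOn Alhazen.focalSum K.curve z) ∧
      (∀ z ∈ K.curve, IsMinOn Alhazen.focalSum K.curve z → K.F4.IsRoot z) ∧
      K.F4.natDegree ≤ 6 ∧
      (K.F4.natDegree = 6 ↔
        Alhazen.coeffW6 K.a (starRingEnd ℂ K.a) K.b (starRingEnd ℂ K.b) K.p K.q ≠ 0) ∧
      ((∀ r : ℝ, 2 < r → K.curve ≠ Alhazen.focalEllipse r) → K.F4 ≠ 0)) ∧
    -- the computation of the triangular ratio metric
    (∀ (G : Alhazen.Conic) (D : Set ℂ) (z₁ z₂ : ℂ), G.Nondegenerate → frontier D = G.curve →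
      z₁ ≠ z₂ →
      (Disjoint (segment ℝ z₁ z₂) G.curve →
        (∃ K : Alhazen.Conic, K.Nondegenerate ∧
          K.curve = Alhazen.normalizing z₁ z₂ '' G.curve) ∧
        (∀ K : Alhazen.Conic, K.Nondegenerate →
          K.curve = Alhazen.normalizing z₁ z₂ '' G.curve →
          (∃ ζ ∈ {z | z ∈ K.curve ∧ K.F4.IsRoot z},
            IsMinOn Alhazen.focalSum {z | z ∈ K.curve ∧ K.F4.IsRoot z} ζ) ∧
          (∀ ζ ∈ {z | z ∈ K.curve ∧ K.F4.IsRoot z},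
            IsMinOn Alhazen.focalSum {z | z ∈ K.curve ∧ K.F4.IsRoot z} ζ →
            Alhazen.triangularRatio D z₁ z₂ = Alhazen.ratioSup K.curve 1 (-1) ∧
            Alhazen.ratioSup K.curve 1 (-1) = 2 / (‖1 - ζ‖ + ‖ζ + 1‖)))) ∧
      (¬ Disjoint (segment ℝ z₁ z₂) G.curve → Alhazen.triangularRatio D z₁ z₂ = 1)) := by
  refine ⟨fun K hK hd => ⟨Alhazen.exists_isMinOn_focalSum K.isClosed_curve hK.2,
    fun z hz hmin => Alhazen.Conic.isRoot_F4_of_isMinOn hK.1 hd hz hmin, K.natDegree_F4_le,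
    K.natDegree_F4_eq_iff, Alhazen.Conic.F4_ne_zero hK hd⟩, fun G D z₁ z₂ hG hD h =>
    ⟨fun hd => ⟨Alhazen.Conic.exists_image_normalizing h hG, fun K hK hKG => ?_⟩, fun hd => ?_⟩⟩
  · have hd' : Disjoint (segment ℝ (-1 : ℂ) 1) K.curve :=
      hKG ▸ Alhazen.disjoint_image_normalizing h hd
    obtain ⟨w, hw, hwmin⟩ := Alhazen.exists_isMinOn_focalSum K.isClosed_curve hK.2
    have hwroot := Alhazen.Conic.isRoot_F4_of_isMinOn hK.1 hd' hw hwmin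
    refine ⟨⟨w, ⟨hw, hwroot⟩, hwmin.on_subset fun z hz => hz.1⟩, fun ζ hζ hmin => ⟨?_, ?_⟩⟩
    · rw [Alhazen.triangularRatio, hD, hKG, Alhazen.ratioSup_image_normalizing h]
    -- The global minimizer `w` is itself a root, so a minimum over the roots on the curve is a
    -- minimum over the whole curve.
    · exact Alhazen.ratioSup_eq_of_isMinOn hζ.1 <| isMinOn_iff.2 fun z hz =>
        (isMinOn_iff.1 hmin w ⟨hw, hwroot⟩).trans (isMinOn_iff.1 hwmin z hz)
  · rw [Alhazen.triangularRatio, hD]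
    exact Alhazen.ratioSup_eq_one h hd
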